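/- Let $E$ and $F$ be (real) Banach lattices with norm duals $E'$, $F'$, where $F'$ carries the dual order ($f\le g$ iff $f(x)\le g(x)$ for all $x\in F^+$), under which it is again a Banach lattice. Let $T:E\to F$ be a bounded linear operator with adjoint $T':F'\to E'$, $T'f=f\circ T$, and let $\mathcal S\subset F'$ be norm bounded, with solid hull $\mathrm{sol}(\mathcal S)=\{f\in F' : |f|\le |h| \text{ for some } h\in\mathcal S\}$. A net $(f_\alpha)$ in $F'$ is called uaw-null if $|f_\alpha|\wedge g\to 0$ weakly (for $\sigma(F',F'')$) for every $g\in (F')^+$, and uaw$^*$-null if $|f_\alpha|\wedge g\to 0$ weak$^*$ (for $\sigma(F',F)$) for every $g\in (F')^+$. The operator $T'$ is called $\mathcal S$-L-weakly compact if $\|T'f_n\|\to 0$ for every uaw-null sequence $(f_n)\subset \mathrm{sol}(\mathcal S)$. Then the following statements are equivalent: 1. $T'$ is $\mathcal S$-L-weakly compact. 2. For each $\varepsilon>0$ there exist $g\in (F')^+$ and $u\in F^+$ such that $\|T'f\|\le (|f|\wedge g)(u)+\varepsilon$ for all $f\in \mathrm{sol}(\mathcal S)$. 3. For every uaw$^*$-null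 net $(f_\alpha)\subset \mathrm{sol}(\mathcal S)$, $\|T'f_\alpha\|\to 0$. 4. For every uaw$^*$-null sequence $(f_n)\subset \mathrm{sol}(\mathcal S)$, $\|T'f_n\|\to 0$. -/

import Mathlib

open Filter Topology

universe u v w

/-! ### The norm dual of a Banach lattice as a Banach lattice

For a Banach lattice `F` the dual `F'` is `StrongDual ℝ F`, ordered by `f ≤ g` iff `f x ≤ g x` for
all `x ≥ 0`. Positive parts are given by the Riesz-Kantorovich formula
`f⁺ x = sup {f y | 0 ≤ y ≤ x}` for `x ≥ 0`. -/

namespace DualLattice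

section

variable {F : Type*} [NormedAddCommGroup F] [Lattice F] [HasSolidNorm F] [IsOrderedAddMonoid F]
  [NormedSpace ℝ F]

/-- The value `sup {f y | 0 ≤ y ≤ x}` of the positive part of `f` at `x ≥ 0`. -/
noncomputable def coneSup (f : StrongDual ℝ F) (x : F) : ℝ := sSup (f '' Set.Icc 0 x)

theorem norm_le_of_mem_Icc {x y : F} (hy : y ∈ Set.Icc 0 x) : ‖y‖ ≤ ‖x‖ :=
  HasSolidNorm.solid (by rw [abs_of_nonneg hy.1, abs_of_nonneg (hy.1.trans hy.2)]; exact hy.2)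

theorem apply_le_of_mem_Icc (f : StrongDual ℝ F) {x y : F} (hy : y ∈ Set.Icc 0 x) :
    f y ≤ ‖f‖ * ‖x‖ :=
  (le_abs_self _).trans ((f.le_opNorm y).trans
    (mul_le_mul_of_nonneg_left (norm_le_of_mem_Icc hy) (norm_nonneg f)))

theorem le_coneSup (f : StrongDual ℝ F) {x y : F} (hy : y ∈ Set.Icc 0 x) : f y ≤ coneSup f x :=
  le_csSup ⟨‖f‖ * ‖x‖, by rintro _ ⟨z, hz, rfl⟩; exact apply_le_of_mem_Icc f hz⟩ ⟨y, hy, rfl⟩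

theorem coneSup_le (f : StrongDual ℝ F) {x : F} (hx : 0 ≤ x) {c : ℝ}
    (h : ∀ y ∈ Set.Icc 0 x, f y ≤ c) : coneSup f x ≤ c :=
  csSup_le ⟨f 0, 0, ⟨le_rfl, hx⟩, rfl⟩ (by rintro _ ⟨z, hz, rfl⟩; exact h z hz)

theorem coneSup_nonneg (f : StrongDual ℝ F) {x : F} (hx : 0 ≤ x) : 0 ≤ coneSup f x := by
  simpa using le_coneSup f (y := 0) ⟨le_rfl, hx⟩

theorem coneSup_add (f : StrongDual ℝ F) {a b : F} (ha : 0 ≤ a) (hb : 0 ≤ b) :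
    coneSup f (a + b) = coneSup f a + coneSup f b := by
  apply le_antisymm
  · refine coneSup_le f (add_nonneg ha hb) fun y hy => ?_
    have h1 : y ⊓ a ∈ Set.Icc 0 a := ⟨le_inf hy.1 ha, inf_le_right⟩
    have h2 : y - y ⊓ a ∈ Set.Icc 0 b := by
      refine ⟨sub_nonneg.2 inf_le_left, ?_⟩
      rw [sub_le_comm]
      exact le_inf (sub_le_self _ hb) (sub_le_iff_le_add.2 hy.2)
    have h3 : f y = f (y ⊓ a) + f (y - y ⊓ a) := by rw [← map_add]; congr 1; abel
    rw [h3]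
    exact add_le_add (le_coneSup f h1) (le_coneSup f h2)
  · rw [← le_sub_iff_add_le]
    refine coneSup_le f ha fun y hy => ?_
    rw [le_sub_comm]
    refine coneSup_le f hb fun z hz => ?_
    rw [le_sub_iff_add_le, add_comm, ← map_add]
    exact le_coneSup f ⟨add_nonneg hy.1 hz.1, add_le_add hy.2 hz.2⟩

theorem coneSup_sub (f : StrongDual ℝ F) {x a b : F} (ha : 0 ≤ a) (hb : 0 ≤ b) (h : x = a - b) :
    coneSup f x⁺ - coneSup f x⁻ = coneSup f a - coneSup f b := by
  have h1 : x⁺ + b = a + x⁻ := by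
    have := posPart_sub_negPart x
    rw [← sub_eq_sub_iff_add_eq_add, this, h]
  have h2 := congrArg (coneSup f) h1
  rw [coneSup_add f (posPart_nonneg x) hb, coneSup_add f ha (negPart_nonneg x)] at h2
  linarith

/-- The positive part `f⁺` of a functional `f`, extended from the positive cone by
`f⁺ x = f⁺ (x⁺) - f⁺ (x⁻)`. -/
noncomputable def dualPosPart (f : StrongDual ℝ F) : StrongDual ℝ F :=
  AddMonoidHom.toRealLinearMap
    { toFun := fun x => coneSup f x⁺ - coneSup f x⁻
      map_zero' := by simp
      map_add' := fun x y => by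
        rw [coneSup_sub f (a := x⁺ + y⁺) (b := x⁻ + y⁻)
          (add_nonneg (posPart_nonneg x) (posPart_nonneg y))
          (add_nonneg (negPart_nonneg x) (negPart_nonneg y))
          (by conv_lhs => rw [← posPart_sub_negPart x, ← posPart_sub_negPart y]
              abel),
          coneSup_add f (posPart_nonneg x) (posPart_nonneg y),
          coneSup_add f (negPart_nonneg x) (negPart_nonneg y)]
        ring }
    (by
      refine AddMonoidHomClass.continuous_of_bound _ ‖f‖ fun x => ?_
      have key : ∀ z : F, 0 ≤ z → z ≤ |x| → coneSup f z ≤ ‖f‖ * ‖x‖ := fun z hz hzx =>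
        coneSup_le f hz fun y hy => by
          have := apply_le_of_mem_Icc f (x := |x|) ⟨hy.1, hy.2.trans hzx⟩
          rwa [norm_abs_eq_norm] at this
      have h1 := key x⁺ (posPart_nonneg x) (sup_le (le_abs_self x) (abs_nonneg x))
      have h2 := key x⁻ (negPart_nonneg x) (sup_le (neg_le_abs x) (abs_nonneg x))
      have h3 := coneSup_nonneg f (posPart_nonneg x)
      have h4 := coneSup_nonneg f (negPart_nonneg x)
      simp only [AddMonoidHom.coe_mk, ZeroHom.coe_mk, Real.norm_eq_abs]
      exact abs_sub_le_iff.2 ⟨by linarith, by linarith⟩)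

theorem dualPosPart_apply (f : StrongDual ℝ F) {x : F} (hx : 0 ≤ x) :
    dualPosPart f x = coneSup f x := by
  change coneSup f x⁺ - coneSup f x⁻ = _
  rw [coneSup_sub f hx le_rfl (sub_zero x).symm]
  have : coneSup f 0 = 0 :=
    le_antisymm (coneSup_le f le_rfl fun y hy => by
      rw [le_antisymm hy.2 hy.1, map_zero]) (coneSup_nonneg f le_rfl)
  rw [this, sub_zero]

/-- The order of the dual: `f ≤ g` iff `f x ≤ g x` for all `x ≥ 0`. -/
noncomputable instance instPartialOrder : PartialOrder (StrongDual ℝ F) where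
  le f g := ∀ x : F, 0 ≤ x → f x ≤ g x
  le_refl f x _ := le_rfl
  le_trans f g h hfg hgh x hx := (hfg x hx).trans (hgh x hx)
  le_antisymm f g hfg hgf := by
    ext x
    rw [← posPart_sub_negPart x, map_sub, map_sub,
      le_antisymm (hfg _ (posPart_nonneg x)) (hgf _ (posPart_nonneg x)),
      le_antisymm (hfg _ (negPart_nonneg x)) (hgf _ (negPart_nonneg x))]

theorem le_def {f g : StrongDual ℝ F} : f ≤ g ↔ ∀ x : F, 0 ≤ x → f x ≤ g x := Iff.rfl

instance instIsOrderedAddMonoid : IsOrderedAddMonoid (StrongDual ℝ F) where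
  add_le_add_left f g h k x hx := by
    simpa using h x hx

theorem le_dualPosPart (f : StrongDual ℝ F) : f ≤ dualPosPart f := fun x hx => by
  rw [dualPosPart_apply f hx]
  exact le_coneSup f ⟨hx, le_rfl⟩

theorem dualPosPart_nonneg (f : StrongDual ℝ F) : 0 ≤ dualPosPart f := fun x hx => by
  rw [dualPosPart_apply f hx]
  exact coneSup_nonneg f hx

theorem dualPosPart_le {f g : StrongDual ℝ F} (h : f ≤ g) (hg : 0 ≤ g) : dualPosPart f ≤ g :=
  fun x hx => by
    rw [dualPosPart_apply f hx]
    refine coneSup_le f hx fun y hy => (h y hy.1).trans ?_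
    have := hg (x - y) (sub_nonneg.2 hy.2)
    rw [map_sub] at this
    simpa using this

/-- The lattice operations of the dual: `f ⊔ g = g + (f - g)⁺` and `f ⊓ g = f - (f - g)⁺`. -/
noncomputable instance instLattice : Lattice (StrongDual ℝ F) where
  sup f g := g + dualPosPart (f - g)
  le_sup_left f g := by
    have := le_dualPosPart (f - g)
    rwa [sub_le_iff_le_add'] at this
  le_sup_right f g := le_add_of_nonneg_right (dualPosPart_nonneg _)
  sup_le f g h hf hg := by
    rw [← le_sub_iff_add_le']
    exact dualPosPart_le (sub_le_sub_right hf g) (sub_nonneg.2 hg)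
  inf f g := f - dualPosPart (f - g)
  inf_le_left f g := sub_le_self _ (dualPosPart_nonneg _)
  inf_le_right f g := by
    rw [sub_le_comm]
    exact le_dualPosPart _
  le_inf h f g hf hg := by
    rw [le_sub_comm]
    exact dualPosPart_le (sub_le_sub_left hg f) (sub_nonneg.2 hf)

theorem abs_apply_le (f : StrongDual ℝ F) (x : F) : |f x| ≤ |f| |x| := by
  have h : ∀ y : F, 0 ≤ y → |f y| ≤ |f| y := fun y hy =>
    abs_le'.2 ⟨le_abs_self f y hy, neg_le_abs f y hy⟩
  have h1 := h _ (posPart_nonneg x)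
  have h2 := h _ (negPart_nonneg x)
  rw [← posPart_add_negPart x, map_add]
  conv_lhs => rw [← posPart_sub_negPart x, map_sub]
  exact (abs_sub _ _).trans (add_le_add h1 h2)

theorem abs_apply_abs_le (f : StrongDual ℝ F) (x : F) : |f| |x| ≤ ‖f‖ * ‖x‖ := by
  have h0 : |f| = dualPosPart (f - -f) - f := by
    change -f + dualPosPart (f - -f) = _
    abel
  rw [h0, _root_.sub_apply, dualPosPart_apply _ (abs_nonneg x), sub_le_iff_le_add]
  refine coneSup_le _ (abs_nonneg x) fun y hy => ?_
  have h1 : |(y + y - |x| : F)| ≤ |x| := by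
    refine abs_le'.2 ⟨?_, ?_⟩
    · rw [sub_le_iff_le_add]; exact add_le_add hy.2 hy.2
    · rw [neg_sub]; exact sub_le_self _ (add_nonneg hy.1 hy.1)
  have h2 : f (y + y - |x|) ≤ ‖f‖ * ‖x‖ :=
    (le_abs_self _).trans ((f.le_opNorm _).trans
      (mul_le_mul_of_nonneg_left (HasSolidNorm.solid h1) (norm_nonneg f)))
  rw [map_sub, map_add] at h2
  simp only [_root_.sub_apply, _root_.neg_apply]
  linarith

instance instHasSolidNorm : HasSolidNorm (StrongDual ℝ F) where
  solid f g h := f.opNorm_le_bound (norm_nonneg g) fun x =>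
    (abs_apply_le f x).trans ((h |x| (abs_nonneg x)).trans (abs_apply_abs_le g x))

end

end DualLattice

/-! ### Unbounded absolute weak and weak* convergence -/

/-- `x` is uaw-convergent to `a` along `l`: `|x i - a| ⊓ z → 0` weakly, for every `z ≥ 0`. -/
def UAWTendsto {E : Type*} [NormedAddCommGroup E] [Lattice E] [HasSolidNorm E]
    [IsOrderedAddMonoid E] [NormedSpace ℝ E] {ι : Type*} (x : ι → E) (l : Filter ι) (a : E) :
    Prop :=
  ∀ z : E, 0 ≤ z → Tendsto (fun i => toWeakSpace ℝ E (|x i - a| ⊓ z)) l (𝓝 0)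

/-- `f` is uaw*-convergent to `g` along `l`: `|f i - g| ⊓ h → 0` weak*, for every `h ≥ 0` in the
dual. -/
def UAWStarTendsto {F : Type*} [NormedAddCommGroup F] [Lattice F] [HasSolidNorm F]
    [IsOrderedAddMonoid F] [NormedSpace ℝ F] {ι : Type*} (f : ι → StrongDual ℝ F) (l : Filter ι)
    (g : StrongDual ℝ F) : Prop :=
  ∀ h : StrongDual ℝ F, 0 ≤ h →
    Tendsto (fun i => StrongDual.toWeakDual (|f i - g| ⊓ h)) l (𝓝 0)

/-- `T : E → Y` is `S`-L-weakly compact: `T` maps the uaw-null sequences in the solid hull of `S`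
to norm null sequences. -/
def IsSLWeaklyCompact {E : Type*} [NormedAddCommGroup E] [Lattice E] [HasSolidNorm E]
    [IsOrderedAddMonoid E] [NormedSpace ℝ E] {Y : Type*} [NormedAddCommGroup Y] [NormedSpace ℝ Y]
    (S : Set E) (T : E →L[ℝ] Y) : Prop :=
  ∀ x : ℕ → E, (∀ n, x n ∈ LatticeOrderedAddCommGroup.solidClosure S) →
    UAWTendsto x atTop 0 → Tendsto (fun n => T (x n)) atTop (𝓝 0)

/-! Let `B` be the solid hull of the image under `T` of the unit ball. Then `‖T' f‖` is at most the
supremum of `|f| y` over the positive `y ∈ B`, and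
`|f| y ≤ (|f| ⊓ g) z + (|f| - g)⁺ y + g (y - z)⁺`,
so everything rests on making the last two terms uniformly small. Both come from one truncation
principle of Aliprantis and Burkinshaw: if a norm bounded set `P` of positive functionals tends to
zero along every positive disjoint sequence of a norm bounded solid set `A`, uniformly in the
choice of a functional for each term, then `A` is uniformly `P`-close to an order interval. It is
applied first to `A = sol(S)` and the point evaluations at `B`, which gives `g`, and then to
`A = B` and `P = {g}`, which gives `z`. Its hypothesis reduces to the norm convergence of `T'` on
uaw-null sequences of `sol(S)`. In the first case the disjoint sequence is itself uaw-null. In the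
second, the disjoint sequence `y n` lies in `B`, and the components of a functional `f ∈ sol(S)`
on the principal ideals of the `y n` have order bounded partial sums, so that they form a uaw-null
sequence. -/

/-! ### Disjoint elements of a lattice ordered group -/

/-- Disjointness of two elements of a lattice ordered group. Mathlib's `Disjoint` is not available
because such a group has no least element. -/
def LatticeDisjoint {G : Type*} [AddGroup G] [Lattice G] (a b : G) : Prop := |a| ⊓ |b| = 0

section LatticeGroup

variable {G : Type*} [AddCommGroup G] [Lattice G]

instance LatticeDisjoint.instSymm : Std.Symm (LatticeDisjoint (G := G)) :=
  ⟨fun a b h => (inf_comm |b| |a|).trans h⟩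

variable [IsOrderedAddMonoid G]

theorem add_inf_le_inf_add_inf {a b c : G} (ha : 0 ≤ a) (hb : 0 ≤ b) (hc : 0 ≤ c) :
    (a + b) ⊓ c ≤ a ⊓ c + b ⊓ c := by
  rw [inf_add, add_inf, add_inf]
  exact le_inf (le_inf inf_le_left (inf_le_right.trans (le_add_of_nonneg_left ha)))
    (le_inf (inf_le_right.trans (le_add_of_nonneg_right hb))
      (inf_le_right.trans (le_add_of_nonneg_right hc)))

theorem add_posPart_le (a b : G) : (a + b)⁺ ≤ a⁺ + b⁺ :=
  sup_le (add_le_add (le_posPart a) (le_posPart b))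
    (add_nonneg (posPart_nonneg a) (posPart_nonneg b))

namespace LatticeDisjoint

theorem mono {a b c d : G} (h : LatticeDisjoint c d) (hac : |a| ≤ |c|) (hbd : |b| ≤ |d|) :
    LatticeDisjoint a b :=
  le_antisymm ((inf_le_inf hac hbd).trans_eq h) (le_inf (abs_nonneg a) (abs_nonneg b))

theorem mono_of_nonneg {a b c d : G} (h : LatticeDisjoint c d) (ha : 0 ≤ a) (hb : 0 ≤ b)
    (hac : a ≤ c) (hbd : b ≤ d) : LatticeDisjoint a b :=
  h.mono (abs_le_abs_of_nonneg ha hac) (abs_le_abs_of_nonneg hb hbd)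

theorem posPart_negPart (a : G) : LatticeDisjoint a⁺ a⁻ := by
  rw [LatticeDisjoint, abs_of_nonneg (posPart_nonneg a), abs_of_nonneg (negPart_nonneg a),
    posPart_inf_negPart_eq_zero]

theorem add_left {a b c : G} (hac : LatticeDisjoint a c) (hbc : LatticeDisjoint b c) :
    LatticeDisjoint (a + b) c := by
  refine le_antisymm ?_ (le_inf (abs_nonneg _) (abs_nonneg c))
  calc |a + b| ⊓ |c| ≤ (|a| + |b|) ⊓ |c| := inf_le_inf_right _ (abs_add_le a b)
    _ ≤ |a| ⊓ |c| + |b| ⊓ |c| :=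
      add_inf_le_inf_add_inf (abs_nonneg a) (abs_nonneg b) (abs_nonneg c)
    _ = 0 := by rw [hac, hbc, add_zero]

theorem sum_left {ι : Type*} {s : Finset ι} {w : ι → G} {c : G}
    (h : ∀ i ∈ s, LatticeDisjoint (w i) c) : LatticeDisjoint (∑ i ∈ s, w i) c :=
  Finset.sum_induction w (LatticeDisjoint · c) (fun _ _ => add_left)
    (by rw [LatticeDisjoint, abs_zero, inf_eq_left.2 (abs_nonneg c)]) h

theorem sum_le {ι : Type*} {w : ι → G} {x : G} (hw : Pairwise (Function.onFun LatticeDisjoint w))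
    (hw0 : ∀ i, 0 ≤ w i) (hx : 0 ≤ x) (hwx : ∀ i, w i ≤ x) (s : Finset ι) :
    ∑ i ∈ s, w i ≤ x := by
  classical
  induction s using Finset.induction_on with
  | empty => simpa using hx
  | insert i s hi ih =>
    have hdisj : (∑ j ∈ s, w j) ⊓ w i = 0 := by
      have h : LatticeDisjoint (∑ j ∈ s, w j) (w i) :=
        sum_left fun j hj => hw (ne_of_mem_of_not_mem hj hi)
      rwa [LatticeDisjoint, abs_of_nonneg (Finset.sum_nonneg fun j _ => hw0 j),
        abs_of_nonneg (hw0 i)] at h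
    rw [Finset.sum_insert hi, add_comm, ← inf_add_sup, hdisj, zero_add]
    exact sup_le ih (hwx i)

end LatticeDisjoint

end LatticeGroup

section VectorLattice

variable {E : Type*} [AddCommGroup E] [Lattice E] [Module ℝ E] [IsOrderedModule ℝ E]

theorem smul_inf_of_pos {c : ℝ} (hc : 0 < c) (x y : E) : c • (x ⊓ y) = c • x ⊓ c • y :=
  (OrderIso.smulRight hc).map_inf x y

theorem abs_smul_le (c : ℝ) (x : E) : |c • x| ≤ |c| • |x| := by
  rcases le_total 0 c with hc | hc
  · rw [abs_of_nonneg hc]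
    exact abs_le'.2 ⟨smul_le_smul_of_nonneg_left (le_abs_self x) hc,
      (smul_neg c x).ge.trans (smul_le_smul_of_nonneg_left (neg_le_abs x) hc)⟩
  · rw [abs_of_nonpos hc, ← neg_smul_neg]
    exact abs_le'.2 ⟨smul_le_smul_of_nonneg_left (neg_le_abs x) (neg_nonneg.2 hc), by
      rw [← smul_neg, neg_neg]
      exact smul_le_smul_of_nonneg_left (le_abs_self x) (neg_nonneg.2 hc)⟩

variable [IsOrderedAddMonoid E]

theorem LatticeDisjoint.smul {a b : E} (h : LatticeDisjoint a b) (c : ℝ) :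
    LatticeDisjoint (c • a) (c • b) := by
  rcases eq_or_ne c 0 with rfl | hc
  · simp [LatticeDisjoint]
  refine le_antisymm ?_ (le_inf (abs_nonneg _) (abs_nonneg _))
  calc |c • a| ⊓ |c • b| ≤ |c| • |a| ⊓ |c| • |b| := inf_le_inf (abs_smul_le c a) (abs_smul_le c b)
    _ = 0 := by rw [← smul_inf_of_pos (abs_pos.2 hc), h, smul_zero]

theorem LatticeDisjoint.posPart_sub_smul {c : ℝ} (hc : 1 ≤ c) (a b : E) :
    LatticeDisjoint (a - c • b)⁺ (b - c⁻¹ • a)⁺ := by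
  have hc0 : 0 < c := zero_lt_one.trans_le hc
  refine (posPart_negPart (a - c • b)).mono_of_nonneg (posPart_nonneg _) (posPart_nonneg _) le_rfl
    (sup_le ?_ (negPart_nonneg _))
  calc b - c⁻¹ • a = c⁻¹ • -(a - c • b) := by
        rw [neg_sub, smul_sub, inv_smul_smul₀ hc0.ne']
    _ ≤ c⁻¹ • (a - c • b)⁻ := smul_le_smul_of_nonneg_left (neg_le_negPart _) (inv_pos.2 hc0).le
    _ ≤ (a - c • b)⁻ := smul_le_of_le_one_left (negPart_nonneg _) (inv_le_one_of_one_le₀ hc)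

/-! ### Disjointification of a sequence -/

/-- The Aliprantis–Burkinshaw disjointification of a positive sequence `f` relative to a common
upper bound `u` of the elements `2⁻ⁿ f n`. The subtracted sum makes the `n`-th term disjoint from
the earlier ones, and subtracting `2⁻ⁿ u` makes it disjoint from the later ones. -/
noncomputable def disjointification (f : ℕ → E) (u : E) (n : ℕ) : E :=
  (f n - (4 : ℝ) ^ n • ∑ k ∈ Finset.range n, f k - (2⁻¹ : ℝ) ^ n • u)⁺

variable {f : ℕ → E} {u : E}

theorem disjointification_le (hf : ∀ n, 0 ≤ f n) (hu : 0 ≤ u) (n : ℕ) :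
    disjointification f u n ≤ f n :=
  sup_le ((sub_le_self _ (smul_nonneg (by positivity) hu)).trans
    (sub_le_self _ (smul_nonneg (by positivity) (Finset.sum_nonneg fun k _ => hf k)))) (hf n)

theorem posPart_sub_le_disjointification_add (hu : 0 ≤ u) (n : ℕ) :
    (f n - (4 : ℝ) ^ n • ∑ k ∈ Finset.range n, f k)⁺ ≤
      disjointification f u n + (2⁻¹ : ℝ) ^ n • u := by
  have h := add_posPart_le (f n - (4 : ℝ) ^ n • ∑ k ∈ Finset.range n, f k - (2⁻¹ : ℝ) ^ n • u)
    ((2⁻¹ : ℝ) ^ n • u)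
  rwa [sub_add_cancel, posPart_of_nonneg (smul_nonneg (by positivity) hu)] at h

theorem pairwise_latticeDisjoint_disjointification (hf : ∀ n, 0 ≤ f n)
    (hfu : ∀ n, (2⁻¹ : ℝ) ^ n • f n ≤ u) :
    Pairwise (Function.onFun LatticeDisjoint (disjointification f u)) := by
  have hu : 0 ≤ u := (smul_nonneg (by positivity) (hf 0)).trans (hfu 0)
  refine (Std.Symm.pairwise_on _).2 fun m n hmn => symm ?_
  refine (LatticeDisjoint.posPart_sub_smul (one_le_pow₀ (n := n) (by norm_num : (1 : ℝ) ≤ 4)) (f n)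
    (f m)).mono_of_nonneg (posPart_nonneg _) (posPart_nonneg _) (posPart_mono ?_)
    (posPart_mono ?_)
  · calc _ ≤ f n - (4 : ℝ) ^ n • ∑ k ∈ Finset.range n, f k :=
          sub_le_self _ (smul_nonneg (by positivity) hu)
      _ ≤ f n - (4 : ℝ) ^ n • f m := sub_le_sub_left (smul_le_smul_of_nonneg_left
          (Finset.single_le_sum (fun i _ => hf i) (Finset.mem_range.2 hmn)) (by positivity)) _
  · have hpow : ((4 : ℝ) ^ n)⁻¹ ≤ 2⁻¹ ^ m * 2⁻¹ ^ n := by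
      rw [← inv_pow, show (4⁻¹ : ℝ) = 2⁻¹ * 2⁻¹ by norm_num, mul_pow]
      exact mul_le_mul_of_nonneg_right
        (pow_le_pow_of_le_one (by norm_num) (by norm_num) hmn.le) (by positivity)
    calc _ ≤ f m - (2⁻¹ : ℝ) ^ m • u := sub_le_sub_right (sub_le_self _
          (smul_nonneg (by positivity) (Finset.sum_nonneg fun k _ => hf k))) _
      _ ≤ f m - (2⁻¹ : ℝ) ^ m • (2⁻¹ : ℝ) ^ n • f n :=
          sub_le_sub_left (smul_le_smul_of_nonneg_left (hfu n) (by positivity)) _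
      _ ≤ f m - ((4 : ℝ) ^ n)⁻¹ • f n := by
          rw [smul_smul]
          exact sub_le_sub_left (smul_le_smul_of_nonneg_right hpow (hf n)) _

end VectorLattice

/-! ### Positive functionals and their components on principal ideals -/

theorem exists_strongDual_apply_eq_and_abs_le {F : Type*} [NormedAddCommGroup F] [NormedSpace ℝ F]
    {p : Seminorm ℝ F} (hp : Continuous p) (v : F) :
    ∃ h : StrongDual ℝ F, h v = p v ∧ ∀ x, |h x| ≤ p x := by
  rcases eq_or_ne v 0 with rfl | hv
  · exact ⟨0, by simp, fun x => by simp⟩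
  have hle : ∀ x : Submodule.span ℝ {v},
      (p v • (LinearEquiv.coord ℝ F v hv).toLinearMap) x ≤ p x := fun x => by
    conv_rhs => rw [← LinearEquiv.coord_apply_smul ℝ F v hv x, map_smul_eq_mul, mul_comm]
    exact mul_le_mul_of_nonneg_left (le_abs_self _) (apply_nonneg p v)
  obtain ⟨h, hext, habs⟩ := Module.Dual.exists_continuous_extension_of_le_seminorm_real _ _ hp hle
  refine ⟨h, ?_, habs⟩
  simpa [LinearEquiv.coord_self] using hext ⟨v, Submodule.mem_span_singleton_self v⟩

namespace DualLattice

variable {F : Type*} [NormedAddCommGroup F] [Lattice F] [IsOrderedAddMonoid F] [NormedSpace ℝ F]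

instance instIsOrderedModule : IsOrderedModule ℝ (StrongDual ℝ F) where
  smul_le_smul_of_nonneg_left _ hc _ _ h x hx := mul_le_mul_of_nonneg_left (h x hx) hc
  smul_le_smul_of_nonneg_right _ hf _ _ h x hx := mul_le_mul_of_nonneg_right h (hf x hx)

theorem apply_mono {f : StrongDual ℝ F} (hf : 0 ≤ f) : Monotone f := fun x y hxy => by
  simpa [sub_nonneg] using hf (y - x) (sub_nonneg.2 hxy)

theorem bddAbove_range_apply_inf {f : StrongDual ℝ F} (hf : 0 ≤ f) (y x : F) :
    BddAbove (Set.range fun t : NNReal => f (|x| ⊓ (t : ℝ) • y)) :=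
  ⟨f |x|, by rintro _ ⟨t, rfl⟩; exact apply_mono hf inf_le_left⟩

section

variable [HasSolidNorm F]

theorem posPart_apply (f : StrongDual ℝ F) {x : F} (hx : 0 ≤ x) : f⁺ x = coneSup f x := by
  change (0 + dualPosPart (f - 0)) x = _
  rw [zero_add, sub_zero, dualPosPart_apply f hx]

theorem abs_apply_le_of_forall_le {h : StrongDual ℝ F} {x : F} (hx : 0 ≤ x) {c : ℝ}
    (hc : ∀ y : F, |y| ≤ x → h y ≤ c) : |h| x ≤ c := by
  have habs : |h| x = 2 * coneSup h x - h x := by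
    rw [← posPart_apply h hx, eq_sub_iff_add_eq]
    simpa [two_mul, two_nsmul] using DFunLike.congr_fun (abs_add_eq_two_nsmul_posPart h) x
  have hsup : coneSup h x ≤ (c + h x) / 2 := coneSup_le h hx fun y hy => by
    have hyx : |y + y - x| ≤ x := abs_le'.2
      ⟨sub_le_iff_le_add.2 (add_le_add hy.2 hy.2),
        (neg_sub (y + y) x).trans_le (sub_le_self _ (add_nonneg hy.1 hy.1))⟩
    have := hc _ hyx
    rw [map_sub, map_add] at this
    linarith
  linarith

theorem apply_le_inf_apply_add {f g : StrongDual ℝ F} (hf : 0 ≤ f) (hg : 0 ≤ g) (y z : F) :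
    f y ≤ (f ⊓ g) z + ((f - g)⁺ y + g (y - z)⁺) := by
  have hsplit : f y = (f ⊓ g) y + (f - g)⁺ y := by
    rw [← _root_.add_apply, inf_eq_sub_posPart_sub, sub_add_cancel]
  have hyz : (f ⊓ g) y ≤ (f ⊓ g) z + (f ⊓ g) (y - z)⁺ := by
    rw [← map_add]
    exact apply_mono (le_inf hf hg) (sub_le_iff_le_add'.1 (le_posPart _))
  have hle : (f ⊓ g) (y - z)⁺ ≤ g (y - z)⁺ := (inf_le_right : f ⊓ g ≤ g) _ (posPart_nonneg _)
  linarith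

end

variable [IsOrderedModule ℝ F]

/-- The seminorm `x ↦ g |x|`, where the functional `g` is the component of the positive functional
`f` on the ideal generated by `y ≥ 0`, that is `g x = sup_t f (x ⊓ t y)` for `x ≥ 0`. As a seminorm
it can be used in the Hahn-Banach theorem without first extending `g` from the positive cone. -/
noncomputable def componentSeminorm (f : StrongDual ℝ F) (hf : 0 ≤ f) (y : F) (hy : 0 ≤ y) :
    Seminorm ℝ F :=
  Seminorm.ofSMulLE (fun x => ⨆ t : NNReal, f (|x| ⊓ (t : ℝ) • y))
    (by simp [inf_eq_left.2 (smul_nonneg (NNReal.coe_nonneg _) hy)])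
    (fun a b => ciSup_le fun t => by
      have hty : 0 ≤ (t : ℝ) • y := smul_nonneg t.2 hy
      calc f (|a + b| ⊓ (t : ℝ) • y) ≤ f (|a| ⊓ (t : ℝ) • y + |b| ⊓ (t : ℝ) • y) :=
            apply_mono hf ((inf_le_inf_right _ (abs_add_le a b)).trans
              (add_inf_le_inf_add_inf (abs_nonneg a) (abs_nonneg b) hty))
        _ ≤ _ := by
            rw [map_add]
            exact add_le_add (le_ciSup (bddAbove_range_apply_inf hf y a) t)
              (le_ciSup (bddAbove_range_apply_inf hf y b) t))
    (fun c x => ciSup_le fun t => by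
      rcases eq_or_ne c 0 with rfl | hc
      · simp [inf_eq_left.2 (smul_nonneg (NNReal.coe_nonneg t) hy)]
      have hc' : 0 < |c| := abs_pos.2 hc
      calc f (|c • x| ⊓ (t : ℝ) • y) ≤ f (|c| • (|x| ⊓ (|c|⁻¹ * t) • y)) := by
            rw [smul_inf_of_pos hc', smul_smul, mul_inv_cancel_left₀ hc'.ne']
            exact apply_mono hf (inf_le_inf_right _ (abs_smul_le c x))
        _ ≤ _ := by
            rw [map_smul, smul_eq_mul, Real.norm_eq_abs]
            exact mul_le_mul_of_nonneg_left
              (le_ciSup (bddAbove_range_apply_inf hf y x) ⟨|c|⁻¹ * t, by positivity⟩) hc'.le)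

section Component

variable {f : StrongDual ℝ F} (hf : 0 ≤ f) {y : F} (hy : 0 ≤ y)

theorem le_componentSeminorm (x : F) (t : NNReal) :
    f (|x| ⊓ (t : ℝ) • y) ≤ componentSeminorm f hf y hy x :=
  le_ciSup (bddAbove_range_apply_inf hf y x) t

theorem componentSeminorm_le (x : F) : componentSeminorm f hf y hy x ≤ f |x| :=
  ciSup_le fun _ => apply_mono hf inf_le_left

theorem componentSeminorm_mono {x z : F} (hxz : |x| ≤ |z|) :
    componentSeminorm f hf y hy x ≤ componentSeminorm f hf y hy z :=
  ciSup_mono (bddAbove_range_apply_inf hf y z) fun _ =>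
    apply_mono hf (inf_le_inf_right _ hxz)

theorem tendsto_componentSeminorm (x : F) :
    Tendsto (fun t : NNReal => f (|x| ⊓ (t : ℝ) • y)) atTop (𝓝 (componentSeminorm f hf y hy x)) :=
  tendsto_atTop_ciSup (fun _ _ hst => apply_mono hf
    (inf_le_inf_left _ (smul_le_smul_of_nonneg_right hst hy))) (bddAbove_range_apply_inf hf y x)

variable [HasSolidNorm F]

theorem continuous_componentSeminorm : Continuous (componentSeminorm f hf y hy) := by
  refine Seminorm.continuous_of_le (q := ‖f‖₊ • normSeminorm ℝ F) ?_ fun x => ?_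
  · exact continuous_norm.const_smul ‖f‖₊
  · calc componentSeminorm f hf y hy x ≤ f |x| := componentSeminorm_le hf hy x
      _ ≤ ‖f‖ * ‖|x|‖ := (le_abs_self _).trans (f.le_opNorm _)
      _ = _ := by rw [norm_abs_eq_norm]; rfl

theorem exists_le_apply_and_abs_le_componentSeminorm {v : F} (hyv : y ≤ |v|) :
    ∃ h : StrongDual ℝ F, f y ≤ h v ∧ ∀ x, 0 ≤ x → |h| x ≤ componentSeminorm f hf y hy x := by
  obtain ⟨h, hv, hle⟩ :=
    exists_strongDual_apply_eq_and_abs_le (continuous_componentSeminorm hf hy) v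
  refine ⟨h, ?_, fun x hx => abs_apply_le_of_forall_le hx fun z hz => ?_⟩
  · simpa [hv, inf_eq_right.2 hyv] using le_componentSeminorm hf hy v 1
  · exact ((le_abs_self _).trans (hle z)).trans
      (componentSeminorm_mono hf hy (hz.trans (le_abs_self x)))

end Component

theorem sum_componentSeminorm_le {f : StrongDual ℝ F} (hf : 0 ≤ f) {ι : Type*} {y : ι → F}
    (hy : ∀ i, 0 ≤ y i) (hd : Pairwise (Function.onFun LatticeDisjoint y)) {x : F} (hx : 0 ≤ x)
    (s : Finset ι) : ∑ i ∈ s, componentSeminorm f hf (y i) (hy i) x ≤ f x := by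
  refine le_of_tendsto' (tendsto_finsetSum s fun i _ => tendsto_componentSeminorm hf (hy i) x)
    fun t => ?_
  have hty : ∀ i, 0 ≤ (t : ℝ) • y i := fun i => smul_nonneg t.2 (hy i)
  have h0 : ∀ i, 0 ≤ |x| ⊓ (t : ℝ) • y i := fun i => le_inf (abs_nonneg x) (hty i)
  rw [← map_sum]
  exact apply_mono hf (LatticeDisjoint.sum_le (fun i j hij => ((hd hij).smul t).mono_of_nonneg
    (h0 i) (h0 j) inf_le_right inf_le_right) h0 hx
    (fun i => inf_le_left.trans_eq (abs_of_nonneg hx)) s)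

variable [HasSolidNorm F]

theorem exists_abs_le_and_apply_abs_le {f : StrongDual ℝ F} (hf : 0 ≤ f) {y v : F} (hy : 0 ≤ y)
    (hyv : y ≤ |v|) : ∃ h : StrongDual ℝ F, |h| ≤ f ∧ f y ≤ h v := by
  obtain ⟨h, hv, hle⟩ := exists_le_apply_and_abs_le_componentSeminorm hf hy hyv
  exact ⟨h, fun x hx => (hle x hx).trans
    ((componentSeminorm_le hf hy x).trans_eq (by rw [abs_of_nonneg hx])), hv⟩

theorem exists_sum_abs_le_and_le_apply {f : StrongDual ℝ F} (hf : 0 ≤ f) {ι : Type*} {y v : ι → F}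
    (hy : ∀ i, 0 ≤ y i) (hd : Pairwise (Function.onFun LatticeDisjoint y))
    (hyv : ∀ i, y i ≤ |v i|) :
    ∃ h : ι → StrongDual ℝ F, (∀ s : Finset ι, ∑ i ∈ s, |h i| ≤ f) ∧ ∀ i, f (y i) ≤ h i (v i) := by
  choose h hv hle using fun i => exists_le_apply_and_abs_le_componentSeminorm hf (hy i) (hyv i)
  refine ⟨h, fun s x hx => ?_, hv⟩
  rw [_root_.sum_apply]
  exact (Finset.sum_le_sum fun i _ => hle i x hx).trans (sum_componentSeminorm_le hf hy hd hx s)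

end DualLattice

open DualLattice LatticeOrderedAddCommGroup

/-! ### Unbounded absolute weak convergence of order bounded and of disjoint families -/

theorem isBounded_inclusionInDoubleDual_image {E : Type*} [NormedAddCommGroup E] [NormedSpace ℝ E]
    {A : Set E} (hA : Bornology.IsBounded A) :
    Bornology.IsBounded (NormedSpace.inclusionInDoubleDual ℝ E '' A) := by
  obtain ⟨C, hC⟩ := hA.exists_norm_le
  refine isBounded_iff_forall_norm_le.2 ⟨C, ?_⟩
  rintro _ ⟨x, hx, rfl⟩
  exact (NormedSpace.double_dual_bound ℝ E x).trans (hC x hx)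

theorem isBounded_solidClosure {E : Type*} [NormedAddCommGroup E] [Lattice E] [HasSolidNorm E]
    {A : Set E} (hA : Bornology.IsBounded A) : Bornology.IsBounded (solidClosure A) := by
  obtain ⟨C, hC⟩ := hA.exists_norm_le
  refine isBounded_iff_forall_norm_le.2 ⟨C, ?_⟩
  rintro x ⟨a, ha, hxa⟩
  exact (norm_le_norm_of_abs_le_abs hxa).trans (hC a ha)

section UAW

variable {E : Type*} [NormedAddCommGroup E] [NormedSpace ℝ E]

theorem tendsto_toWeakSpace_zero_iff {ι : Type*} {l : Filter ι} {x : ι → E} :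
    Tendsto (fun i => toWeakSpace ℝ E (x i)) l (𝓝 0) ↔
      ∀ φ : StrongDual ℝ E, Tendsto (fun i => φ (x i)) l (𝓝 0) := by
  have hinj : Function.Injective (topDualPairing ℝ E).flip := fun x y h => by
    by_contra hne
    obtain ⟨φ, hφ⟩ := SeparatingDual.exists_separating_of_ne (R := ℝ) hne
    exact hφ (DFunLike.congr_fun h φ)
  refine (WeakBilin.tendsto_iff_forall_eval_tendsto _ hinj).trans (forall_congr' fun φ => ?_)
  have h0 : (topDualPairing ℝ E).flip 0 φ = 0 := map_zero φ
  change Tendsto _ l (𝓝 ((topDualPairing ℝ E).flip 0 φ)) ↔ _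
  rw [h0]
  rfl

theorem tendsto_toWeakDual_zero_iff {ι : Type*} {l : Filter ι} {f : ι → StrongDual ℝ E} :
    Tendsto (fun i => StrongDual.toWeakDual (f i)) l (𝓝 0) ↔
      ∀ x : E, Tendsto (fun i => f i x) l (𝓝 0) :=
  tendsto_iff_forall_eval_tendsto_topDualPairing

variable [Lattice E] [HasSolidNorm E] [IsOrderedAddMonoid E]

theorem tendsto_apply_cofinite_of_sum_le {ι : Type*} {w : ι → E} (hw : ∀ i, 0 ≤ w i) {g : E}
    (hg : ∀ s : Finset ι, ∑ i ∈ s, w i ≤ g) (φ : StrongDual ℝ E) :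
    Tendsto (fun i => φ (w i)) cofinite (𝓝 0) := by
  have hsummable : Summable fun i => |φ| (w i) :=
    summable_of_sum_le (fun i => (abs_nonneg φ : 0 ≤ |φ|) (w i) (hw i)) fun s =>
      (map_sum |φ| w s).symm.trans_le (apply_mono (abs_nonneg φ) (hg s))
  refine squeeze_zero_norm (fun i => ?_) hsummable.tendsto_cofinite_zero
  simpa only [Real.norm_eq_abs, abs_of_nonneg (hw i)] using abs_apply_le φ (w i)

theorem uawTendsto_cofinite_zero {ι : Type*} {x : ι → E}
    (hx : ∀ z, 0 ≤ z → ∃ g, ∀ s : Finset ι, ∑ i ∈ s, |x i| ⊓ z ≤ g) :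
    UAWTendsto x cofinite 0 := by
  intro z hz
  obtain ⟨g, hg⟩ := hx z hz
  simp only [sub_zero, tendsto_toWeakSpace_zero_iff]
  exact tendsto_apply_cofinite_of_sum_le (fun i => le_inf (abs_nonneg _) hz) hg

theorem uawTendsto_cofinite_zero_of_disjoint {ι : Type*} {x : ι → E}
    (hx : Pairwise (Function.onFun LatticeDisjoint x)) : UAWTendsto x cofinite 0 :=
  uawTendsto_cofinite_zero fun z hz =>
    have h0 : ∀ i, 0 ≤ |x i| ⊓ z := fun _ => le_inf (abs_nonneg _) hz
    have habs : ∀ i, |(|x i| ⊓ z)| ≤ |x i| := fun _ => (abs_of_nonneg (h0 _)).trans_le inf_le_left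
    ⟨z, LatticeDisjoint.sum_le (fun _ _ hij => (hx hij).mono (habs _) (habs _)) h0 hz
      fun _ => inf_le_right⟩

theorem uawTendsto_cofinite_zero_of_sum_abs_le {ι : Type*} {x : ι → E} {g : E}
    (hg : ∀ s : Finset ι, ∑ i ∈ s, |x i| ≤ g) : UAWTendsto x cofinite 0 :=
  uawTendsto_cofinite_zero fun _ _ =>
    ⟨g, fun s => (Finset.sum_le_sum fun _ _ => inf_le_left).trans (hg s)⟩

theorem UAWTendsto.uawStarTendsto {ι : Type*} {l : Filter ι} {f : ι → StrongDual ℝ E}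
    {g : StrongDual ℝ E} (h : UAWTendsto f l g) : UAWStarTendsto f l g := fun k hk =>
  tendsto_toWeakDual_zero_iff.2 fun x =>
    tendsto_toWeakSpace_zero_iff.1 (h k hk) (NormedSpace.inclusionInDoubleDual ℝ E x)

end UAW

/-! ### Approximation by elements of an ideal -/

section Truncation

theorem exists_seq_of_forall_exists_span {E : Type*} [AddCommGroup E] [PartialOrder E]
    [IsOrderedAddMonoid E] [Module ℝ E] [IsOrderedModule ℝ E] {A : Set E} {Q : E → E → Prop}
    {c : ℕ → ℝ} (hc : ∀ n, 0 ≤ c n)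
    (h : ∀ g ∈ Submodule.span ℝ A, 0 ≤ g → ∃ a ∈ A, 0 ≤ a ∧ Q g a) :
    ∃ f : ℕ → E, ∀ n, f n ∈ A ∧ 0 ≤ f n ∧ Q (c n • ∑ k ∈ Finset.range n, f k) (f n) := by
  choose! a haA ha0 haQ using h
  let s : ℕ → E := fun n => Nat.rec 0 (fun n t => t + a (c n • t)) n
  have hs : ∀ n, s n ∈ Submodule.span ℝ A ∧ 0 ≤ s n := fun n => by
    induction n with
    | zero => exact ⟨zero_mem _, le_rfl⟩
    | succ n ih =>
      have hmem := Submodule.smul_mem _ (c n) ih.1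
      have hnonneg := smul_nonneg (hc n) ih.2
      exact ⟨add_mem ih.1 (Submodule.subset_span (haA _ hmem hnonneg)),
        add_nonneg ih.2 (ha0 _ hmem hnonneg)⟩
  have hsum : ∀ n, ∑ k ∈ Finset.range n, a (c k • s k) = s n := fun n => by
    induction n with
    | zero => rfl
    | succ n ih => rw [Finset.sum_range_succ, ih]
  refine ⟨fun n => a (c n • s n), fun n => ?_⟩
  have hmem := Submodule.smul_mem _ (c n) (hs n).1
  have hnonneg := smul_nonneg (hc n) (hs n).2
  exact ⟨haA _ hmem hnonneg, ha0 _ hmem hnonneg, (hsum n).symm ▸ haQ _ hmem hnonneg⟩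

variable {E : Type*} [NormedAddCommGroup E] [Lattice E] [HasSolidNorm E] [IsOrderedAddMonoid E]
  [NormedSpace ℝ E] [IsOrderedModule ℝ E] [CompleteSpace E]

theorem exists_forall_pow_smul_le {f : ℕ → E} (hf : ∀ n, 0 ≤ f n)
    (hbdd : Bornology.IsBounded (Set.range f)) : ∃ u, ∀ n, (2⁻¹ : ℝ) ^ n • f n ≤ u := by
  obtain ⟨C, hC⟩ := hbdd.exists_norm_le
  have hsummable : Summable fun n => (2⁻¹ : ℝ) ^ n • f n := by
    refine Summable.of_norm_bounded (g := fun n => (2⁻¹ : ℝ) ^ n * C)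
      ((summable_geometric_of_lt_one (by norm_num) (by norm_num)).mul_right C) fun n => ?_
    rw [norm_smul, Real.norm_of_nonneg (by positivity)]
    exact mul_le_mul_of_nonneg_left (hC _ ⟨n, rfl⟩) (by positivity)
  exact ⟨_, fun n => hsummable.le_tsum n fun i _ => smul_nonneg (by positivity) (hf i)⟩

theorem exists_disjoint_seq_forall_posPart_sub_le {f : ℕ → E} (hf : ∀ n, 0 ≤ f n)
    (hbdd : Bornology.IsBounded (Set.range f)) :
    ∃ (v : ℕ → E) (u : E), Pairwise (Function.onFun LatticeDisjoint v) ∧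
      (∀ n, 0 ≤ v n) ∧ (∀ n, v n ≤ f n) ∧
      ∀ n, (f n - (4 : ℝ) ^ n • ∑ k ∈ Finset.range n, f k)⁺ ≤ v n + (2⁻¹ : ℝ) ^ n • u := by
  obtain ⟨u, hfu⟩ := exists_forall_pow_smul_le hf hbdd
  have hu : 0 ≤ u := (smul_nonneg (by positivity) (hf 0)).trans (hfu 0)
  exact ⟨disjointification f u, u, pairwise_latticeDisjoint_disjointification hf hfu,
    fun _ => posPart_nonneg _, disjointification_le hf hu, posPart_sub_le_disjointification_add hu⟩

theorem exists_mem_span_forall_apply_posPart_sub_le {A : Set E} {P : Set (StrongDual ℝ E)}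
    (hA : IsSolid A) (hAb : Bornology.IsBounded A) (hP : ∀ φ ∈ P, 0 ≤ φ)
    (hPb : Bornology.IsBounded P)
    (hlim : ∀ (v : ℕ → E) (φ : ℕ → StrongDual ℝ E), (∀ n, v n ∈ A) → (∀ n, 0 ≤ v n) →
      Pairwise (Function.onFun LatticeDisjoint v) → (∀ n, φ n ∈ P) →
      Tendsto (fun n => φ n (v n)) atTop (𝓝 0))
    {ε : ℝ} (hε : 0 < ε) :
    ∃ g ∈ Submodule.span ℝ A, 0 ≤ g ∧ ∀ a ∈ A, ∀ φ ∈ P, φ (|a| - g)⁺ ≤ ε := by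
  -- Otherwise `A` contains terms that stay `ε`-large after subtracting `4 ^ n` times the sum of the
  -- earlier ones, and hence after disjointification.
  by_contra! H
  obtain ⟨f, hf⟩ := exists_seq_of_forall_exists_span
    (Q := fun g a => ∃ φ ∈ P, ε < φ (a - g)⁺) (c := fun n => 4 ^ n) (fun n => by positivity)
    fun g hg hg0 => by
      obtain ⟨a, ha, hφ⟩ := H g hg hg0
      exact ⟨|a|, hA ha (abs_abs a).le, abs_nonneg a, hφ⟩
  choose hfA hf0 φ hφP hφ using hf
  obtain ⟨v, u, hvd, hv0, hvf, hle⟩ := exists_disjoint_seq_forall_posPart_sub_le hf0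
    (hAb.subset (Set.range_subset_iff.2 hfA))
  have hvA : ∀ n, v n ∈ A := fun n => hA (hfA n) (abs_le_abs_of_nonneg (hv0 n) (hvf n))
  obtain ⟨D, hD⟩ := hPb.exists_norm_le
  have hsmall : Tendsto (fun n => φ n (v n) + (2⁻¹ : ℝ) ^ n * (D * ‖u‖)) atTop (𝓝 0) := by
    simpa using (hlim v φ hvA hv0 hvd hφP).add ((tendsto_pow_atTop_nhds_zero_of_lt_one
      (by norm_num : (0 : ℝ) ≤ 2⁻¹) (by norm_num)).mul_const (D * ‖u‖))
  have hlarge : ∀ n, ε ≤ φ n (v n) + (2⁻¹ : ℝ) ^ n * (D * ‖u‖) := fun n => by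
    have hu : φ n u ≤ D * ‖u‖ := (le_abs_self _).trans ((φ n).le_of_opNorm_le (hD _ (hφP n)) u)
    calc ε ≤ φ n (v n + (2⁻¹ : ℝ) ^ n • u) :=
          (hφ n).le.trans (apply_mono (hP _ (hφP n)) (hle n))
      _ ≤ _ := by
          rw [map_add, map_smul, smul_eq_mul]
          gcongr
  exact (ge_of_tendsto' hsmall hlarge).not_gt hε

end Truncation

/-! ### `S`-L-weakly compact adjoints -/

section Adjoint

variable {E : Type*} [NormedAddCommGroup E] [NormedSpace ℝ E]
  {F : Type*} [NormedAddCommGroup F] [Lattice F] [HasSolidNorm F] [IsOrderedAddMonoid F]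
  [NormedSpace ℝ F] {S : Set (StrongDual ℝ F)} {T : E →L[ℝ] F}

theorem norm_comp_le_of_forall_abs_apply_abs_le {f : StrongDual ℝ F} {c : ℝ}
    (h : ∀ x : E, ‖x‖ ≤ 1 → |f| |T x| ≤ c) : ‖f ∘L T‖ ≤ c :=
  ContinuousLinearMap.opNorm_le_of_unit_norm (by simpa using h 0 (by simp)) fun x hx =>
    (abs_apply_le f (T x)).trans (h x hx.le)

theorem tendsto_comp_zero_of_forall_exists_norm_comp_le
    (h : ∀ ε : ℝ, 0 < ε → ∃ g : StrongDual ℝ F, 0 ≤ g ∧ ∃ z : F, 0 ≤ z ∧ ∀ f ∈ solidClosure S,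
      ‖f ∘L T‖ ≤ (|f| ⊓ g) z + ε)
    {ι : Type*} {l : Filter ι} {f : ι → StrongDual ℝ F} (hf : ∀ i, f i ∈ solidClosure S)
    (hf0 : UAWStarTendsto f l 0) : Tendsto (fun i => f i ∘L T) l (𝓝 0) := by
  rw [NormedAddGroup.tendsto_nhds_zero]
  intro ε hε
  obtain ⟨g, hg, z, -, hle⟩ := h (ε / 2) (half_pos hε)
  have hlim := tendsto_toWeakDual_zero_iff.1 (hf0 g hg) z
  filter_upwards [hlim.eventually_lt_const (half_pos hε)] with i hi
  rw [sub_zero] at hi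
  linarith [hle (f i) (hf i)]

namespace IsSLWeaklyCompact

theorem tendsto_zero_of_le_apply (hT : IsSLWeaklyCompact S (T.precomp ℝ))
    {h : ℕ → StrongDual ℝ F} (hS : ∀ n, h n ∈ solidClosure S) (h0 : UAWTendsto h cofinite 0)
    {x : ℕ → E} (hx : ∀ n, ‖x n‖ ≤ 1) {a : ℕ → ℝ} (ha : ∀ n, 0 ≤ a n)
    (hax : ∀ n, a n ≤ h n (T (x n))) : Tendsto a atTop (𝓝 0) :=
  squeeze_zero ha
    (fun n => (hax n).trans ((le_abs_self _).trans ((h n ∘L T).unit_le_opNorm (x n) (hx n))))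
    (tendsto_zero_iff_norm_tendsto_zero.1 (hT h hS (Nat.cofinite_eq_atTop ▸ h0)))

variable [IsOrderedModule ℝ F]

theorem tendsto_apply_of_disjoint_functionals (hT : IsSLWeaklyCompact S (T.precomp ℝ))
    {f : ℕ → StrongDual ℝ F} (hf : ∀ n, 0 ≤ f n) (hfS : ∀ n, f n ∈ solidClosure S)
    (hd : Pairwise (Function.onFun LatticeDisjoint f)) {y : ℕ → F} (hy : ∀ n, 0 ≤ y n)
    (hyT : ∀ n, y n ∈ solidClosure (T '' Metric.closedBall 0 1)) :
    Tendsto (fun n => f n (y n)) atTop (𝓝 0) := by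
  simp only [solidClosure, Set.exists_mem_image, mem_closedBall_zero_iff, Set.mem_ofPred_eq] at hyT
  choose x hx hyx using hyT
  choose h hhf hfh using fun n =>
    exists_abs_le_and_apply_abs_le (hf n) (hy n) ((le_abs_self _).trans (hyx n))
  have habs : ∀ n, |h n| ≤ |f n| := fun n => (hhf n).trans (le_abs_self _)
  exact hT.tendsto_zero_of_le_apply (fun n => isSolid_solidClosure S (hfS n) (habs n))
    (uawTendsto_cofinite_zero_of_disjoint fun i j hij => (hd hij).mono (habs i) (habs j)) hx
    (fun n => hf n _ (hy n)) hfh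

theorem tendsto_apply_of_disjoint_vectors (hT : IsSLWeaklyCompact S (T.precomp ℝ))
    {f : StrongDual ℝ F} (hf : f ∈ Submodule.span ℝ (solidClosure S)) {y : ℕ → F}
    (hy : ∀ n, 0 ≤ y n) (hd : Pairwise (Function.onFun LatticeDisjoint y))
    (hyT : ∀ n, y n ∈ solidClosure (T '' Metric.closedBall 0 1)) :
    Tendsto (fun n => f (y n)) atTop (𝓝 0) := by
  simp only [solidClosure, Set.exists_mem_image, mem_closedBall_zero_iff, Set.mem_ofPred_eq] at hyT
  choose x hx hyx using hyT
  induction hf using Submodule.span_induction with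
  | mem f hfS =>
    obtain ⟨h, hsum, hfh⟩ := exists_sum_abs_le_and_le_apply (abs_nonneg f) hy hd
      fun n => (le_abs_self _).trans (hyx n)
    have habs : ∀ n, |h n| ≤ |f| := fun n => by simpa using hsum {n}
    have hlim : Tendsto (fun n => |f| (y n)) atTop (𝓝 0) :=
      hT.tendsto_zero_of_le_apply (fun n => isSolid_solidClosure S hfS (habs n))
        (uawTendsto_cofinite_zero_of_sum_abs_le hsum) hx (fun n => abs_nonneg f _ (hy n)) hfh
    refine squeeze_zero_norm (fun n => ?_) hlim
    simpa only [Real.norm_eq_abs, abs_of_nonneg (hy n)] using abs_apply_le f (y n)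
  | zero => simp
  | add f k _ _ hf hk => simpa using hf.add hk
  | smul c f _ hf => simpa using hf.const_mul c

theorem exists_mem_span_forall_posPart_sub_apply_le (hT : IsSLWeaklyCompact S (T.precomp ℝ))
    (hS : Bornology.IsBounded S) {ε : ℝ} (hε : 0 < ε) :
    ∃ g ∈ Submodule.span ℝ (solidClosure S), 0 ≤ g ∧ ∀ f ∈ solidClosure S,
      ∀ y ∈ solidClosure (T '' Metric.closedBall 0 1), 0 ≤ y → (|f| - g)⁺ y ≤ ε := by
  let J := NormedSpace.inclusionInDoubleDual ℝ F
  let B := solidClosure (T '' Metric.closedBall 0 1) ∩ Set.Ici 0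
  have hB : Bornology.IsBounded B :=
    (isBounded_solidClosure (Metric.isBounded_closedBall.image T)).subset Set.inter_subset_left
  obtain ⟨g, hg, hg0, hle⟩ := exists_mem_span_forall_apply_posPart_sub_le (P := J '' B)
    (isSolid_solidClosure S) (isBounded_solidClosure hS)
    (by rintro _ ⟨y, hy, rfl⟩; exact fun f hf => hf y hy.2)
    (isBounded_inclusionInDoubleDual_image hB)
    (fun f φ hfS hf hd hφ => by
      choose y hy hyφ using hφ
      obtain rfl : (fun n => J (y n)) = φ := funext hyφ
      exact hT.tendsto_apply_of_disjoint_functionals hf hfS hd (fun n => (hy n).2)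
        fun n => (hy n).1) hε
  exact ⟨g, hg, hg0, fun f hf y hyT hy => hle f hf _ ⟨y, ⟨hyT, hy⟩, rfl⟩⟩

theorem exists_forall_apply_posPart_sub_le [CompleteSpace F]
    (hT : IsSLWeaklyCompact S (T.precomp ℝ)) {g : StrongDual ℝ F} (hg : 0 ≤ g)
    (hgS : g ∈ Submodule.span ℝ (solidClosure S)) {ε : ℝ} (hε : 0 < ε) :
    ∃ z : F, 0 ≤ z ∧ ∀ y ∈ solidClosure (T '' Metric.closedBall 0 1), g (|y| - z)⁺ ≤ ε := by
  obtain ⟨z, -, hz, hle⟩ := exists_mem_span_forall_apply_posPart_sub_le (P := {g})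
    (isSolid_solidClosure _) (isBounded_solidClosure (Metric.isBounded_closedBall.image T))
    (by rintro _ rfl; exact hg) Bornology.isBounded_singleton
    (fun y φ hyT hy hd hφ => by
      obtain rfl : φ = fun _ => g := funext hφ
      exact hT.tendsto_apply_of_disjoint_vectors hgS hy hd hyT) hε
  exact ⟨z, hz, fun y hy => hle y hy g rfl⟩

theorem exists_forall_norm_comp_le [CompleteSpace F] (hT : IsSLWeaklyCompact S (T.precomp ℝ))
    (hS : Bornology.IsBounded S) {ε : ℝ} (hε : 0 < ε) :
    ∃ g : StrongDual ℝ F, 0 ≤ g ∧ ∃ z : F, 0 ≤ z ∧ ∀ f ∈ solidClosure S,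
      ‖f ∘L T‖ ≤ (|f| ⊓ g) z + ε := by
  obtain ⟨g, hgS, hg, hgle⟩ := hT.exists_mem_span_forall_posPart_sub_apply_le hS (half_pos hε)
  obtain ⟨z, hz, hzle⟩ := hT.exists_forall_apply_posPart_sub_le hg hgS (half_pos hε)
  refine ⟨g, hg, z, hz, fun f hf => norm_comp_le_of_forall_abs_apply_abs_le fun x hx => ?_⟩
  have hTx : |T x| ∈ solidClosure (T '' Metric.closedBall 0 1) :=
    ⟨T x, Set.mem_image_of_mem T (mem_closedBall_zero_iff.2 hx), (abs_abs _).le⟩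
  calc |f| |T x| ≤ (|f| ⊓ g) z + ((|f| - g)⁺ |T x| + g (|T x| - z)⁺) :=
        apply_le_inf_apply_add (abs_nonneg f) hg _ z
    _ ≤ (|f| ⊓ g) z + (ε / 2 + ε / 2) := by
        gcongr
        · exact hgle f hf _ hTx (abs_nonneg _)
        · simpa only [abs_abs] using hzle _ hTx
    _ = (|f| ⊓ g) z + ε := by rw [add_halves]

end IsSLWeaklyCompact

end Adjoint

theorem theorem3p6_general
    {E : Type u} [NormedAddCommGroup E] [NormedSpace ℝ E]
    {F : Type v} [NormedAddCommGroup F] [Lattice F] [HasSolidNorm F] [IsOrderedAddMonoid F]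
    [NormedSpace ℝ F] [IsOrderedModule ℝ F] [CompleteSpace F]
    (T : E →L[ℝ] F) (S : Set (StrongDual ℝ F)) (hS : Bornology.IsBounded S) :
    [IsSLWeaklyCompact S (T.precomp ℝ : StrongDual ℝ F →L[ℝ] StrongDual ℝ E),
     ∀ ε : ℝ, 0 < ε → ∃ g : StrongDual ℝ F, 0 ≤ g ∧ ∃ z : F, 0 ≤ z ∧
       ∀ f ∈ solidClosure S,
         ‖(T.precomp ℝ : StrongDual ℝ F →L[ℝ] StrongDual ℝ E) f‖ ≤ (|f| ⊓ g) z + ε,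
     ∀ (ι : Type w) [Preorder ι] [IsDirectedOrder ι] [Nonempty ι] (f : ι → StrongDual ℝ F),
       (∀ i, f i ∈ solidClosure S) → UAWStarTendsto f atTop 0 →
         Tendsto (fun i => (T.precomp ℝ : StrongDual ℝ F →L[ℝ] StrongDual ℝ E) (f i))
           atTop (𝓝 0),
     ∀ f : ℕ → StrongDual ℝ F,
       (∀ n, f n ∈ solidClosure S) → UAWStarTendsto f atTop 0 →
         Tendsto (fun n => (T.precomp ℝ : StrongDual ℝ F →L[ℝ] StrongDual ℝ E) (f n))
           atTop (𝓝 0)].TFAE := by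
  tfae_have 1 → 2 := fun h ε hε => h.exists_forall_norm_comp_le hS hε
  tfae_have 2 → 3 := fun h ι _ _ _ f hf hf0 =>
    tendsto_comp_zero_of_forall_exists_norm_comp_le h hf hf0
  tfae_have 3 → 4 := fun h f hf hf0 => by
    have hdown : Tendsto (ULift.down : ULift.{w} ℕ → ℕ) atTop atTop :=
      (ULift.orderIso (α := ℕ)).tendsto_atTop
    exact (h (ULift.{w} ℕ) (f ∘ ULift.down) (fun i => hf i.down)
      fun k hk => (hf0 k hk).comp hdown).comp (ULift.orderIso (α := ℕ)).symm.tendsto_atTop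
  tfae_have 4 → 1 := fun h f hf hf0 => h f hf hf0.uawStarTendsto
  tfae_finish

theorem theorem3p6
    {E : Type u} [NormedAddCommGroup E] [Lattice E] [HasSolidNorm E] [IsOrderedAddMonoid E]
    [NormedSpace ℝ E] [IsOrderedModule ℝ E] [CompleteSpace E]
    {F : Type v} [NormedAddCommGroup F] [Lattice F] [HasSolidNorm F] [IsOrderedAddMonoid F]
    [NormedSpace ℝ F] [IsOrderedModule ℝ F] [CompleteSpace F]
    (T : E →L[ℝ] F) (S : Set (StrongDual ℝ F)) (hS : Bornology.IsBounded S) :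
    [IsSLWeaklyCompact S (T.precomp ℝ : StrongDual ℝ F →L[ℝ] StrongDual ℝ E),
     ∀ ε : ℝ, 0 < ε → ∃ g : StrongDual ℝ F, 0 ≤ g ∧ ∃ z : F, 0 ≤ z ∧
       ∀ f ∈ LatticeOrderedAddCommGroup.solidClosure S,
         ‖(T.precomp ℝ : StrongDual ℝ F →L[ℝ] StrongDual ℝ E) f‖ ≤ (|f| ⊓ g) z + ε,
     ∀ (ι : Type w) [Preorder ι] [IsDirectedOrder ι] [Nonempty ι] (f : ι → StrongDual ℝ F),
       (∀ i, f i ∈ LatticeOrderedAddCommGroup.solidClosure S) → UAWStarTendsto f atTop 0 →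
         Tendsto (fun i => (T.precomp ℝ : StrongDual ℝ F →L[ℝ] StrongDual ℝ E) (f i))
           atTop (𝓝 0),
     ∀ f : ℕ → StrongDual ℝ F,
       (∀ n, f n ∈ LatticeOrderedAddCommGroup.solidClosure S) → UAWStarTendsto f atTop 0 →
         Tendsto (fun n => (T.precomp ℝ : StrongDual ℝ F →L[ℝ] StrongDual ℝ E) (f n))
           atTop (𝓝 0)].TFAE :=
  theorem3p6_general T S hS
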